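/- Let $\rho>1$ and let $E_\rho\subset\mathbb C$ be the open Bernstein ellipse, that is, the open ellipse with foci $\pm1$ whose semi-axes sum up to $\rho$. Let $A$ and $b$ be functions with values in $\mathbb C^{n\times n}$ and $\mathbb C^n$ (in particular, they may be extensions of real-valued functions on $[-1,1]$) that are analytic on $E_\rho$ and continuous on its closure $\overline{E_\rho}$, with $A(t)$ invertible for every $t\in\overline{E_\rho}$. Put $x(t)=A(t)^{-1}b(t)$ and $\kappa_\rho=\max_{t\in\partial E_\rho}\|x(t)\|_2$. For an integer $M\ge 2$ let $\Delta t=2/(M-1)$, let $-1,-1+\Delta t,\dots,1-\Delta t,1$ be the $M$ equispaced past timesteps, and let $\mathcal S$ be the (real or complex) linear span of the values of $x$ at these timesteps. Let $t_i=1+\Delta t$ be the next timestep, and let $$r=\frac{t_i+\sqrt{t_i^2-1}}{\rho},\qquad C(M,R)=\frac{5\sqrt5\,\sqrt{2R+1}\,\sqrt M}{\sqrt{2(M-1)}}.$$ (a) If $r<1$ (equivalently, $t_i\in E_\rho$), then there is an $s^*\in\mathcal S$ that minimizes $\|A(t_i)s-b(t_i)\|_2$ over $s\in\mathcal S$, and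 every such initial guess $s^*$ satisfies $$\|A(t_i)s^*-b(t_i)\|_2\le 2\,\|A(t_i)\|_2\,\kappa_\rho\left[\frac1{1-r}+\frac{C(M,R)\,\rho}{(\rho-1)\sqrt{\rho^2r^2-1}}\right]r^{R+1}$$ for every integer $R$ with $0\le R\le\frac12\sqrt{M-1}$. Here $\|\cdot\|_2$ is the Euclidean norm of a vector and the spectral norm of a matrix. (b) With $R=\lfloor\frac12\sqrt{M-1}\rfloor$, this bound decays root-exponentially in $M$: for every $c<\frac12\log\rho$ its right-hand side is $O(e^{-c\sqrt M})$ as $M\to\infty$. -/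

import Mathlib

/-- Vectors of length `n` with complex entries and the Euclidean norm `‖·‖₂`. -/
abbrev Vec (n : ℕ) : Type := EuclideanSpace ℂ (Fin n)

/-- A matrix as an operator on Euclidean space; its norm `‖op B‖` is the spectral norm `‖B‖₂`. -/
noncomputable def op {n : ℕ} (B : Matrix (Fin n) (Fin n) ℂ) : Vec n →L[ℂ] Vec n :=
  Matrix.toEuclideanCLM (n := Fin n) (𝕜 := ℂ) B

/-- The open Bernstein ellipse `E_ρ`: foci `±1`, semi-major axis `(ρ + ρ⁻¹) / 2` and semi-minor
axis `(ρ - ρ⁻¹) / 2`, so that the semi-axes sum up to `ρ`. -/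
def bernsteinEllipse (ρ : ℝ) : Set ℂ :=
  {z | ‖z - 1‖ + ‖z + 1‖ < ρ + ρ⁻¹}

/-- The extensions of `A` and `b` are analytic on the open ellipse `E_ρ` and continuous on the
closed one (entry by entry), and `A` is invertible on the closed ellipse. -/
structure AnalyticOnEllipse {n : ℕ} (ρ : ℝ) (A : ℂ → Matrix (Fin n) (Fin n) ℂ)
    (b : ℂ → Vec n) : Prop where
  matrix : ∀ i j, DiffContOnCl ℂ (fun z => A z i j) (bernsteinEllipse ρ)
  vector : ∀ i, DiffContOnCl ℂ (fun z => b z i) (bernsteinEllipse ρ)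
  invertible : ∀ z ∈ closure (bernsteinEllipse ρ), IsUnit (A z)

/-- The solution `x(z) = A(z)⁻¹ b(z)` of the parametrized linear system. -/
noncomputable def solution {n : ℕ} (A : ℂ → Matrix (Fin n) (Fin n) ℂ) (b : ℂ → Vec n)
    (z : ℂ) : Vec n :=
  op (A z)⁻¹ (b z)

/-- `κ_ρ`, the maximum of `‖x(z)‖₂` over the boundary of the Bernstein ellipse. -/
noncomputable def kappa {n : ℕ} (ρ : ℝ) (A : ℂ → Matrix (Fin n) (Fin n) ℂ) (b : ℂ → Vec n) : ℝ :=
  sSup ((fun z => ‖solution A b z‖) '' frontier (bernsteinEllipse ρ))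

/-- The step size `Δt = 2 / (M - 1)`. -/
noncomputable def stepSize (M : ℕ) : ℝ := 2 / ((M : ℝ) - 1)

/-- The `M` equispaced past timesteps `-1, -1 + Δt, …, 1 - Δt, 1`. -/
noncomputable def pastTime (M : ℕ) (k : Fin M) : ℝ := -1 + (k : ℕ) * stepSize M

/-- The next timestep `1 + Δt`. -/
noncomputable def nextTime (M : ℕ) : ℝ := 1 + stepSize M

/-- The span over `𝕜` (which is `ℝ` or `ℂ`) of the columns of the history matrix. -/
noncomputable def historySpan (𝕜 : Type) [RCLike 𝕜] {n : ℕ} [Module 𝕜 (Vec n)]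
    (A : ℂ → Matrix (Fin n) (Fin n) ℂ) (b : ℂ → Vec n) (M : ℕ) : Submodule 𝕜 (Vec n) :=
  Submodule.span 𝕜 (Set.range fun k : Fin M => solution A b (pastTime M k : ℂ))

/-- The Euclidean norm of the residual of `s` for the linear system at the next timestep. -/
noncomputable def residualNorm {n : ℕ} (A : ℂ → Matrix (Fin n) (Fin n) ℂ) (b : ℂ → Vec n) (M : ℕ)
    (s : Vec n) : ℝ :=
  ‖op (A (nextTime M : ℂ)) s - b (nextTime M : ℂ)‖

/-- `s` is an initial guess for the next linear system: it minimizes the residual over the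
uncompressed span of the solution history. -/
def IsInitialGuess (𝕜 : Type) [RCLike 𝕜] {n : ℕ} [Module 𝕜 (Vec n)]
    (A : ℂ → Matrix (Fin n) (Fin n) ℂ) (b : ℂ → Vec n) (M : ℕ) (s : Vec n) : Prop :=
  s ∈ historySpan 𝕜 A b M ∧ ∀ v ∈ historySpan 𝕜 A b M, residualNorm A b M s ≤ residualNorm A b M v

/-- `r = (t + √(t² - 1)) / ρ` with `t` the next timestep. -/
noncomputable def rate (ρ : ℝ) (M : ℕ) : ℝ :=
  (nextTime M + √(nextTime M ^ 2 - 1)) / ρ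

/-- `C(M, R) = 5 √5 √(2R + 1) √M / √(2(M - 1))`. -/
noncomputable def constC (M R : ℕ) : ℝ :=
  5 * √5 * √(2 * (R : ℝ) + 1) * √(M : ℝ) / √(2 * ((M : ℝ) - 1))

/-- The right-hand side of the error bound. -/
noncomputable def errorBound {n : ℕ} (ρ : ℝ) (A : ℂ → Matrix (Fin n) (Fin n) ℂ) (b : ℂ → Vec n)
    (M R : ℕ) : ℝ :=
  2 * ‖op (A (nextTime M : ℂ))‖ * kappa ρ A b *
    (1 / (1 - rate ρ M) +
      constC M R * ρ / ((ρ - 1) * √(ρ ^ 2 * rate ρ M ^ 2 - 1))) *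
    rate ρ M ^ (R + 1)

/-!
The solution `x` is analytic on the Bernstein ellipse by Cramer's rule, so it is close to its
truncated Chebyshev series `p` of degree `R`: the Joukowski map `u ↦ (u + u⁻¹) / 2` pulls Cauchy's
formula on the ellipse back to the circle `‖u‖ = ρ`, and the tails of two geometric series bound
`x - p` by `2 κ r ^ (R + 1) / (1 - r)` at the next timestep and by `2 κ ρ ^ (-R) / (ρ - 1)` on
`[-1, 1]` (`circleIntegral_kernel_smul`, `exists_chebyshev_projection`).

Polynomials of degree at most `R` extrapolate stably from the past timesteps. By Markov's
inequality, `4 R² ≤ M - 1` makes the grid fine enough to see at least half of the maximum on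
`[-1, 1]` of such a polynomial, and by extremality of the Chebyshev polynomials it grows at most by
the factor `w ^ R`, `w = t + √(t² - 1)`, up to a point `t ≥ 1`. By the Hahn-Banach theorem for the
maximum norm there are real weights `c_k` with `∑ |c_k| ≤ 2 w ^ R` that extrapolate these
polynomials exactly (`exists_extrapolation_weights`).

The vector `∑ c_k x(t_k)` lies in the real span of the history and differs from `x(t)` by the
truncation error at `t` and the amplified truncation errors at the `t_k`
(`exists_mem_historySpan_norm_sub_le`). As `2 w ^ R` is at most
`C(M, R) w ^ (R + 1) / √(w² - 1)`, its residual satisfies the bound, and so does that of any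
minimizer over the real or the complex span.

For the decay, `w = 1 + 2 / (√M - 1)`, so `w ^ (R + 1)` is bounded, every other factor
grows at most polynomially in `√M`, and `ρ ^ (-(R + 1))` is `O(exp (-(log ρ / 2) √M))`.
-/

/-! ### Polynomial inequalities on and beyond the interval -/

section PolynomialBounds

open Polynomial

/-- The Joukowski substitution turns the Chebyshev polynomials into symmetric powers. -/
theorem eval_T_joukowski {K : Type*} [Field K] [NeZero (2 : K)] {z : K} (hz : z ≠ 0) (k : ℕ) :
    (Chebyshev.T K k).eval ((z + z⁻¹) / 2) = (z ^ k + (z⁻¹) ^ k) / 2 := by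
  have h2 : (2 : K) ≠ 0 := NeZero.ne 2
  induction k using Nat.twoStepInduction with
  | zero => simp
  | one => simp
  | more k ih1 ih2 =>
    have := Chebyshev.T_add_two K k
    push_cast at ih1 ih2 ⊢
    rw [this]
    simp only [eval_sub, eval_mul, eval_ofNat, eval_X, ih1, ih2]
    have hinv : z * z⁻¹ = 1 := mul_inv_cancel₀ hz
    generalize z⁻¹ = y at hinv ⊢
    field_simp
    linear_combination (y ^ k + z ^ k) * hinv

/-- `t + √(t² - 1)` is the preimage of `t ≥ 1` of modulus at least `1` under the Joukowski map; its
inverse is the other preimage. -/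
theorem add_sqrt_inv {t : ℝ} (ht : 1 ≤ t) : (t + √(t ^ 2 - 1))⁻¹ = t - √(t ^ 2 - 1) := by
  have h : 0 ≤ t ^ 2 - 1 := by nlinarith
  have h' := Real.sq_sqrt h
  have h0 := Real.sqrt_nonneg (t ^ 2 - 1)
  refine inv_eq_of_mul_eq_one_right ?_
  nlinarith

theorem eval_T_le_pow {t : ℝ} (ht : 1 ≤ t) (k : ℕ) :
    (Polynomial.Chebyshev.T ℝ k).eval t ≤ (t + √(t ^ 2 - 1)) ^ k := by
  set w := t + √(t ^ 2 - 1) with hw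
  have hw1 : 1 ≤ w := by have := Real.sqrt_nonneg (t ^ 2 - 1); linarith
  have ht' : t = (w + w⁻¹) / 2 := by rw [hw, add_sqrt_inv ht]; ring
  rw [ht', eval_T_joukowski (by positivity)]
  have : w⁻¹ ^ k ≤ w ^ k := by gcongr; exact (inv_le_one_of_one_le₀ hw1).trans hw1
  linarith

/-- Extremality of the Chebyshev polynomials outside `[-1, 1]`: a polynomial of degree at most `n`
bounded by `B` on the interval grows there no faster than `B * T n`. -/
theorem abs_eval_le_of_one_le {P : ℝ[X]} {n : ℕ} (hP : P.natDegree ≤ n) {B : ℝ} (hB : 0 < B)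
    (h : ∀ x ∈ Set.Icc (-1 : ℝ) 1, |P.eval x| ≤ B) {t : ℝ} (ht : 1 ≤ t) :
    |P.eval t| ≤ B * (t + √(t ^ 2 - 1)) ^ n := by
  have key : ∀ s : ℝ, |s| = 1 → s * P.eval t ≤ B * (t + √(t ^ 2 - 1)) ^ n := by
    intro s hs
    have := Chebyshev.eval_iterate_derivative_le_of_forall_abs_le_one (n := n)
      (P := C (s / B) * P) (k := 0) ht
      (natDegree_le_iff_degree_le.1 ((natDegree_C_mul_le _ _).trans hP)) (fun x hx => by
        simp only [eval_mul, eval_C, abs_mul, abs_div, hs, abs_of_pos hB]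
        rw [one_div, inv_mul_le_iff₀ hB]
        simpa using h x hx)
    simp only [Function.iterate_zero, id, eval_mul, eval_C] at this
    have h2 := this.trans (eval_T_le_pow ht n)
    rw [div_mul_eq_mul_div, div_le_iff₀ hB] at h2
    linarith
  rw [abs_le]
  have h1 := key 1 (by simp)
  have h2 := key (-1) (by simp)
  constructor <;> linarith

/-- **Markov's inequality** at the endpoint `1`. -/
theorem abs_eval_derivative_one_le {P : ℝ[X]} {n : ℕ} (hP : P.natDegree ≤ n) {B : ℝ} (hB : 0 < B)
    (h : ∀ x ∈ Set.Icc (-1 : ℝ) 1, |P.eval x| ≤ B) :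
    |(derivative P).eval 1| ≤ B * n ^ 2 := by
  have key : ∀ s : ℝ, |s| = 1 → s * (derivative P).eval 1 ≤ B * n ^ 2 := by
    intro s hs
    have := Chebyshev.eval_iterate_derivative_le_of_forall_abs_le_one (n := n)
      (P := C (s / B) * P) (k := 1) (le_refl (1 : ℝ))
      (natDegree_le_iff_degree_le.1 ((natDegree_C_mul_le _ _).trans hP)) (fun x hx => by
        simp only [eval_mul, eval_C, abs_mul, abs_div, hs, abs_of_pos hB]
        rw [one_div, inv_mul_le_iff₀ hB]
        simpa using h x hx)
    simp only [Function.iterate_one, derivative_C_mul, eval_mul, eval_C,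
      Chebyshev.derivative_T_eval_one] at this
    rw [div_mul_eq_mul_div, div_le_iff₀ hB] at this
    push_cast at this
    linarith
  rw [abs_le]
  have h1 := key 1 (by simp)
  have h2 := key (-1) (by simp)
  constructor <;> linarith

/-- **Markov's inequality** on the whole interval, with twice the sharp constant: the longer of
`[-1, x]` and `[x, 1]` has length at least `1`, and the endpoint inequality rescales to it. -/
theorem abs_eval_derivative_le {P : ℝ[X]} {n : ℕ} (hP : P.natDegree ≤ n) {B : ℝ} (hB : 0 < B)
    (h : ∀ x ∈ Set.Icc (-1 : ℝ) 1, |P.eval x| ≤ B) {x : ℝ} (hx : x ∈ Set.Icc (-1 : ℝ) 1) :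
    |(derivative P).eval x| ≤ 2 * n ^ 2 * B := by
  wlog hx0 : 0 ≤ x generalizing P x
  · have := this (P := P.comp (-X)) (x := -x) ((natDegree_comp_le).trans (by simpa using hP))
      (fun y hy => by
        have := h (-y) ⟨by linarith [hy.2], by linarith [hy.1]⟩
        simpa using this)
      ⟨by linarith [hx.2], by linarith [hx.1]⟩ (by linarith)
    simpa [derivative_comp] using this
  · have hd := abs_eval_derivative_one_le (P := P.comp (C ((x + 1) / 2) * X + C ((x - 1) / 2)))
      (n := n) ((natDegree_comp_le).trans (by
        refine le_trans (Nat.mul_le_mul hP (natDegree_linear_le)) (by simp))) hB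
      (fun y hy => by
        have := h ((x + 1) / 2 * y + (x - 1) / 2)
          ⟨by nlinarith [hy.1, hx.1], by nlinarith [hy.2, hx.2]⟩
        simpa using this)
    simp only [derivative_comp, eval_mul, eval_comp, eval_add, eval_C, eval_X, derivative_add,
      derivative_C_mul, derivative_X, derivative_C, mul_one, add_zero] at hd
    rw [show (x + 1) / 2 + (x - 1) / 2 = x by ring, abs_mul, abs_of_nonneg (by linarith)] at hd
    have := abs_nonneg ((derivative P).eval x)
    nlinarith

/-! ### Stable extrapolation from an equispaced grid -/

/-- Every point of `[-1, 1]` lies within half a step of the equispaced grid. -/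
theorem exists_pastTime_near {M : ℕ} (hM : 2 ≤ M) {x : ℝ} (hx : x ∈ Set.Icc (-1 : ℝ) 1) :
    ∃ k : Fin M, |x - pastTime M k| ≤ 1 / ((M : ℝ) - 1) := by
  have hM' : (2 : ℝ) ≤ M := by exact_mod_cast hM
  have hM1 : (0 : ℝ) < M - 1 := by linarith
  set y := (x + 1) / 2 * ((M : ℝ) - 1) with hy
  have hy0 : 0 ≤ y := mul_nonneg (by linarith [hx.1]) hM1.le
  have hy1 : y ≤ M - 1 := by
    have : (x + 1) / 2 ≤ 1 := by linarith [hx.2]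
    nlinarith
  set j := ⌊y + 1 / 2⌋₊ with hj
  have hj1 : (j : ℝ) ≤ y + 1 / 2 := Nat.floor_le (by linarith)
  have hj2 : y + 1 / 2 < j + 1 := Nat.lt_floor_add_one _
  have hjM : j < M := by
    have : (j : ℝ) < M := by linarith
    exact_mod_cast this
  refine ⟨⟨j, hjM⟩, ?_⟩
  have : x - pastTime M ⟨j, hjM⟩ = (y - j) * (2 / ((M : ℝ) - 1)) := by
    simp only [pastTime, stepSize, hy]; field_simp; ring
  rw [this, abs_mul, abs_of_pos (by positivity : 0 < 2 / ((M : ℝ) - 1)), ← mul_div_assoc]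
  gcongr
  have : |y - j| ≤ 1 / 2 := abs_le.2 ⟨by linarith, by linarith⟩
  linarith

theorem pastTime_mem_Icc {M : ℕ} (hM : 2 ≤ M) (k : Fin M) : pastTime M k ∈ Set.Icc (-1 : ℝ) 1 := by
  have hM' : (2 : ℝ) ≤ M := by exact_mod_cast hM
  have hM1 : (0 : ℝ) < M - 1 := by linarith
  have hk : ((k : ℕ) : ℝ) + 1 ≤ M := by exact_mod_cast k.2
  have h : 0 ≤ (k : ℕ) * stepSize M := by unfold stepSize; positivity
  refine ⟨by simp only [pastTime]; linarith, ?_⟩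
  have : (k : ℕ) * stepSize M ≤ 2 := by
    rw [stepSize, ← mul_div_assoc, div_le_iff₀ hM1]; linarith
  simp only [pastTime]; linarith

/-- An equispaced grid of at least `4 R² + 1` points sees a polynomial of degree at most `R` up to a
factor `2`: by Markov's inequality it drops by at most half of its maximum on the way from a point
where the maximum is attained to the nearest grid point. -/
theorem abs_eval_le_two_mul_of_pastTime {M R : ℕ} (hM : 2 ≤ M) (hR : 4 * (R : ℝ) ^ 2 ≤ M - 1)
    {P : ℝ[X]} (hP : P.natDegree ≤ R) {m : ℝ} (hm : 0 < m)
    (h : ∀ k : Fin M, |P.eval (pastTime M k)| ≤ m) {x : ℝ} (hx : x ∈ Set.Icc (-1 : ℝ) 1) :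
    |P.eval x| ≤ 2 * m := by
  have hM' : (2 : ℝ) ≤ M := by exact_mod_cast hM
  have hM1 : (0 : ℝ) < M - 1 := by linarith
  obtain ⟨y, hy, hmax⟩ := isCompact_Icc.exists_isMaxOn (⟨x, hx⟩ : (Set.Icc (-1 : ℝ) 1).Nonempty)
    (f := fun x => |P.eval x|) (P.continuous.abs.continuousOn)
  refine le_trans (b := |P.eval y|) (hmax hx) ?_
  rcases (abs_nonneg (P.eval y)).eq_or_lt with h0 | hB
  · rw [← h0]; positivity
  obtain ⟨k, hk⟩ := exists_pastTime_near hM hy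
  have hmv := (convex_Icc (-1 : ℝ) 1).norm_image_sub_le_of_norm_hasDerivWithin_le
    (f := fun x => P.eval x) (f' := fun x => (derivative P).eval x)
    (fun z _ => (P.hasDerivAt z).hasDerivWithinAt)
    (fun z hz => by
      rw [Real.norm_eq_abs]
      exact abs_eval_derivative_le hP hB (fun u hu => hmax hu) hz)
    (pastTime_mem_Icc hM k) hy
  simp only [Real.norm_eq_abs] at hmv
  have h1 : 2 * (R : ℝ) ^ 2 * |P.eval y| * |y - pastTime M k| ≤ |P.eval y| / 2 := by
    calc 2 * (R : ℝ) ^ 2 * |P.eval y| * |y - pastTime M k|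
        ≤ 2 * (R : ℝ) ^ 2 * |P.eval y| * (1 / ((M : ℝ) - 1)) := by gcongr
      _ = |P.eval y| * (4 * (R : ℝ) ^ 2 / (2 * ((M : ℝ) - 1))) := by field_simp; ring
      _ ≤ |P.eval y| * (1 / 2) := by
        refine mul_le_mul_of_nonneg_left ?_ hB.le
        rw [div_le_iff₀ (by positivity)]
        linarith
      _ = _ := by ring
  have h2 := abs_sub_abs_le_abs_sub (P.eval y) (P.eval (pastTime M k))
  have h3 := h k
  linarith

/-- Extrapolation from the grid to a point `t ≥ 1` is stable on polynomials of degree at most `R`. -/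
theorem abs_eval_le_pow_mul_of_pastTime {M R : ℕ} (hM : 2 ≤ M) (hR : 4 * (R : ℝ) ^ 2 ≤ M - 1)
    {P : ℝ[X]} (hP : P.natDegree ≤ R) {m : ℝ} (hm : 0 ≤ m)
    (h : ∀ k : Fin M, |P.eval (pastTime M k)| ≤ m) {t : ℝ} (ht : 1 ≤ t) :
    |P.eval t| ≤ 2 * (t + √(t ^ 2 - 1)) ^ R * m := by
  -- The case `m = 0` is the limit of positive bounds.
  have key : ∀ m' : ℝ, m < m' → |P.eval t| ≤ 2 * (t + √(t ^ 2 - 1)) ^ R * m' := by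
    intro m' hm'
    have := abs_eval_le_of_one_le hP (B := 2 * m') (by linarith) (fun x hx =>
      abs_eval_le_two_mul_of_pastTime hM hR hP (hm.trans_lt hm') (fun k => (h k).trans hm'.le) hx) ht
    linarith
  have hc : Filter.Tendsto (fun m' : ℝ => 2 * (t + √(t ^ 2 - 1)) ^ R * m')
      (nhdsWithin m (Set.Ioi m)) (nhds (2 * (t + √(t ^ 2 - 1)) ^ R * m)) :=
    (Continuous.tendsto (by fun_prop) m).mono_left nhdsWithin_le_nhds
  exact ge_of_tendsto hc (Filter.eventually_of_mem self_mem_nhdsWithin key)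

/-- Real extrapolation weights on the grid that are exact on polynomials of degree at most `R` and
have small `ℓ¹` norm. They represent a norm-preserving extension of the functional
`(P(t_k))_k ↦ P(t)` from the sampled polynomials to all grid functions with the maximum norm. -/
theorem exists_extrapolation_weights {M R : ℕ} (hM : 2 ≤ M) (hR : 4 * (R : ℝ) ^ 2 ≤ M - 1)
    {t : ℝ} (ht : 1 ≤ t) :
    ∃ c : Fin M → ℝ, ∑ k, |c k| ≤ 2 * (t + √(t ^ 2 - 1)) ^ R ∧
      ∀ P : ℝ[X], P.natDegree ≤ R → ∑ k, c k * P.eval (pastTime M k) = P.eval t := by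
  set L := 2 * (t + √(t ^ 2 - 1)) ^ R with hL
  have hL0 : 0 ≤ L := by have := Real.sqrt_nonneg (t ^ 2 - 1); positivity
  let V := degreeLE ℝ (R : WithBot ℕ)
  have hV : ∀ P : ℝ[X], P ∈ V ↔ P.natDegree ≤ R := fun P => by
    rw [mem_degreeLE, natDegree_le_iff_degree_le]
  let ev : V →ₗ[ℝ] (Fin M → ℝ) := (LinearMap.pi fun k => leval (pastTime M k)) ∘ₗ V.subtype
  let ℓ : V →ₗ[ℝ] ℝ := leval t ∘ₗ V.subtype
  have hbd : ∀ P : V, |ℓ P| ≤ L * ‖ev P‖ := fun P =>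
    abs_eval_le_pow_mul_of_pastTime hM hR ((hV _).1 P.2) (norm_nonneg _)
      (fun k => norm_le_pi_norm (ev P) k) ht
  -- `hbd` makes evaluation at `t` vanish on the kernel of sampling, so it factors through `ev`.
  obtain ⟨g, hg⟩ : ∃ g : (Fin M → ℝ) →ₗ[ℝ] ℝ, g ∘ₗ ev = ℓ := by
    have : ℓ ∈ LinearMap.range ev.dualMap := by
      rw [LinearMap.range_dualMap_eq_dualAnnihilator_ker, Submodule.mem_dualAnnihilator]
      intro P hP
      have := hbd P
      rw [LinearMap.mem_ker.1 hP, norm_zero, mul_zero] at this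
      exact abs_eq_zero.1 (le_antisymm this (abs_nonneg _))
    obtain ⟨g, hg⟩ := this
    exact ⟨g, hg⟩
  obtain ⟨G, hG, hGn⟩ := _root_.exists_extension_norm_eq (LinearMap.range ev)
    ((g ∘ₗ (LinearMap.range ev).subtype).mkContinuous L (by
      rintro ⟨_, P, rfl⟩
      have := hbd P
      rw [← hg] at this
      exact this))
  have hGL : ‖G‖ ≤ L := hGn ▸ LinearMap.mkContinuous_norm_le _ hL0 _
  have hGsum : ∀ v : Fin M → ℝ, G v = ∑ k, G (Pi.single k 1) * v k := by
    intro v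
    conv_lhs => rw [pi_eq_sum_univ' v]
    simp [mul_comm]
  refine ⟨fun k => G (Pi.single k 1), ?_, ?_⟩
  -- The `ℓ¹` norm of the weights is attained at their sign vector, which has norm at most `1`.
  · have h1 : ∑ k, |G (Pi.single k 1)| = G (fun k => SignType.sign (G (Pi.single k 1))) := by
      rw [hGsum]
      exact Finset.sum_congr rfl fun k _ => (self_mul_sign _).symm
    rw [h1]
    refine (le_abs_self _).trans ((G.le_opNorm _).trans ?_)
    refine (mul_le_of_le_one_right (norm_nonneg _) ?_).trans hGL
    refine (pi_norm_le_iff_of_nonneg zero_le_one).2 fun k => ?_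
    rcases SignType.sign (G (Pi.single k 1)) with _ | _ | _ <;> simp
  · intro P hP
    have h1 := hG ⟨ev ⟨P, (hV P).2 hP⟩, LinearMap.mem_range_self _ _⟩
    have h2 := LinearMap.congr_fun hg ⟨P, (hV P).2 hP⟩
    rw [hGsum] at h1
    exact h1.trans h2

end PolynomialBounds

/-! ### The Joukowski map and the Bernstein ellipse -/

/-- The Joukowski map `u ↦ (u + u⁻¹) / 2`. It carries the circle of radius `ρ > 1` about `0` onto the
boundary of the Bernstein ellipse `E_ρ`, and the unit circle onto `[-1, 1]`. -/
noncomputable def joukowski (u : ℂ) : ℂ := (u + u⁻¹) / 2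

theorem norm_joukowski_sub_one_add {u : ℂ} (hu : u ≠ 0) :
    ‖joukowski u - 1‖ + ‖joukowski u + 1‖ = ‖u‖ + ‖u‖⁻¹ := by
  have hn : ‖u‖ ≠ 0 := norm_ne_zero_iff.2 hu
  have h1 : joukowski u - 1 = (u - 1) ^ 2 / (2 * u) := by
    unfold joukowski; field_simp; ring
  have h2 : joukowski u + 1 = (u + 1) ^ 2 / (2 * u) := by
    unfold joukowski; field_simp; ring
  have h3 := parallelogram_law_with_norm ℝ u 1
  rw [h1, h2]
  simp only [norm_div, norm_mul, norm_pow, Complex.norm_ofNat, norm_one] at h3 ⊢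
  field_simp
  nlinarith

theorem isOpen_bernsteinEllipse (ρ : ℝ) : IsOpen (bernsteinEllipse ρ) :=
  isOpen_lt (by fun_prop) continuous_const

theorem joukowski_mem_bernsteinEllipse {ρ : ℝ} (hρ : 1 < ρ) {u : ℂ} (h1 : 1 ≤ ‖u‖)
    (h2 : ‖u‖ < ρ) : joukowski u ∈ bernsteinEllipse ρ := by
  have hu : u ≠ 0 := norm_pos_iff.1 (by linarith)
  rw [bernsteinEllipse, Set.mem_ofPred_eq, norm_joukowski_sub_one_add hu]
  have h0 : 0 < ‖u‖ := by linarith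
  have : ρ + ρ⁻¹ - (‖u‖ + ‖u‖⁻¹) = (ρ - ‖u‖) * (ρ * ‖u‖ - 1) / (ρ * ‖u‖) := by
    field_simp; ring
  have h3 : 0 < (ρ - ‖u‖) * (ρ * ‖u‖ - 1) / (ρ * ‖u‖) := by
    have : 0 < ρ * ‖u‖ - 1 := by nlinarith
    have : 0 < ρ - ‖u‖ := by linarith
    positivity
  linarith

theorem continuousAt_joukowski {u : ℂ} (hu : u ≠ 0) : ContinuousAt joukowski u := by
  unfold joukowski
  exact ((continuousAt_id.add (continuousAt_inv₀ hu)).div_const 2)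

theorem differentiableAt_joukowski {u : ℂ} (hu : u ≠ 0) : DifferentiableAt ℂ joukowski u := by
  unfold joukowski
  exact ((differentiableAt_id.add (differentiableAt_inv hu)).div_const 2)

theorem joukowski_mem_closure {ρ : ℝ} (hρ : 1 < ρ) {u : ℂ} (h1 : 1 ≤ ‖u‖)
    (h2 : ‖u‖ ≤ ρ) : joukowski u ∈ closure (bernsteinEllipse ρ) := by
  rcases h2.lt_or_eq with h2 | h2
  · exact subset_closure (joukowski_mem_bernsteinEllipse hρ h1 h2)
  have hu : u ≠ 0 := norm_pos_iff.1 (by linarith)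
  have ht : Filter.Tendsto (fun s : ℝ => joukowski (s * u)) (nhdsWithin 1 (Set.Iio 1))
      (nhds (joukowski u)) := by
    have : ContinuousAt (fun s : ℝ => joukowski (s * u)) 1 := by
      refine ContinuousAt.comp (g := joukowski) (f := fun s : ℝ => (s : ℂ) * u) ?_ (by fun_prop)
      exact continuousAt_joukowski (by simpa using hu)
    have := this.tendsto.mono_left (nhdsWithin_le_nhds (s := Set.Iio 1))
    simpa using this
  -- The image of the radial segment from `u` inwards stays in the open ellipse.
  refine mem_closure_of_tendsto ht ?_
  have hρ' : ρ⁻¹ < 1 := inv_lt_one_of_one_lt₀ hρ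
  filter_upwards [Ioo_mem_nhdsLT hρ'] with s hs
  have hs0 : 0 < s := lt_trans (by positivity) hs.1
  refine joukowski_mem_bernsteinEllipse hρ ?_ ?_
  · rw [norm_mul, Complex.norm_real, Real.norm_of_nonneg hs0.le, h2]
    have := mul_le_mul_of_nonneg_right hs.1.le (by linarith : 0 ≤ ρ)
    rwa [inv_mul_cancel₀ (by linarith)] at this
  · rw [norm_mul, Complex.norm_real, Real.norm_of_nonneg hs0.le, h2]
    nlinarith [hs.2]

theorem joukowski_mem_frontier {ρ : ℝ} (hρ : 1 < ρ) {u : ℂ} (h : ‖u‖ = ρ) :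
    joukowski u ∈ frontier (bernsteinEllipse ρ) := by
  rw [(isOpen_bernsteinEllipse ρ).frontier_eq]
  refine ⟨joukowski_mem_closure hρ (by linarith) h.le, ?_⟩
  rw [bernsteinEllipse, Set.mem_ofPred_eq,
    norm_joukowski_sub_one_add (norm_pos_iff.1 (by linarith)), h]
  exact lt_irrefl _

theorem isCompact_closure_bernsteinEllipse (ρ : ℝ) : IsCompact (closure (bernsteinEllipse ρ)) := by
  refine Bornology.IsBounded.isCompact_closure ?_
  refine (Metric.isBounded_closedBall (x := (1 : ℂ)) (r := ρ + ρ⁻¹)).subset fun z hz => ?_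
  rw [Metric.mem_closedBall, dist_eq_norm]
  have := norm_nonneg (z + 1)
  have : ‖z - 1‖ + ‖z + 1‖ < ρ + ρ⁻¹ := hz
  linarith

theorem exists_joukowski_eq_of_mem_Icc {x : ℝ} (hx : x ∈ Set.Icc (-1 : ℝ) 1) :
    ∃ u : ℂ, ‖u‖ = 1 ∧ joukowski u = x := by
  refine ⟨Complex.exp (Real.arccos x * Complex.I), Complex.norm_exp_ofReal_mul_I _, ?_⟩
  rw [joukowski, ← Complex.exp_neg, ← neg_mul, ← Complex.cos, ← Complex.ofReal_cos,
    Real.cos_arccos hx.1 hx.2]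

theorem joukowski_add_sqrt {t : ℝ} (ht : 1 ≤ t) :
    joukowski ((t + √(t ^ 2 - 1) : ℝ) : ℂ) = t := by
  rw [joukowski, ← Complex.ofReal_inv, add_sqrt_inv ht]
  push_cast
  ring

/-! ### Cauchy's formula and truncated Chebyshev series on the ellipse -/

open scoped Real in
/-- On the unit circle, `joukowski u` is even in the angle while the differential of `joukowski` is
odd. -/
theorem circleIntegral_joukowski_eq_zero {E : Type*} [NormedAddCommGroup E] [NormedSpace ℂ E]
    (g : ℂ → E) : (∮ u in C(0, 1), ((1 - (u⁻¹) ^ 2) / 2) • g (joukowski u)) = 0 := by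
  have h : ∀ θ : ℝ, deriv (circleMap 0 1) θ • ((1 - ((circleMap 0 1 θ)⁻¹) ^ 2) / 2) •
      g (joukowski (circleMap 0 1 θ)) = (-Real.sin θ) • g (Real.cos θ : ℝ) := by
    intro θ
    have h1 : circleMap 0 1 θ = Complex.exp (θ * Complex.I) := by simp [circleMap]
    rw [deriv_circleMap, h1, joukowski, smul_smul, ← Complex.exp_neg, ← neg_mul, ← Complex.cos,
      ← Complex.ofReal_cos, ← Complex.coe_smul]
    congr 1
    have h2 : Complex.exp (θ * Complex.I) * Complex.exp (-θ * Complex.I) = 1 := by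
      rw [← Complex.exp_add]; simp
    rw [Complex.ofReal_neg, Complex.ofReal_sin, Complex.sin]
    linear_combination (-Complex.I * Complex.exp (-θ * Complex.I) / 2) * h2
  rw [circleIntegral]
  simp_rw [h]
  have hper : Function.Periodic (fun θ : ℝ => (-Real.sin θ) • g (Real.cos θ : ℝ)) (2 * π) := by
    intro θ; simp
  have h0 := hper.intervalIntegral_add_eq 0 (-π)
  rw [zero_add, show -π + 2 * π = π by ring] at h0
  rw [h0]
  have hneg := intervalIntegral.integral_comp_neg (a := -π) (b := π)
    (fun θ : ℝ => (-Real.sin θ) • g (Real.cos θ : ℝ))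
  simp only [Real.sin_neg, Real.cos_neg, neg_neg] at hneg
  have h3 : (∫ θ in (-π)..π, (-Real.sin θ) • g (Real.cos θ : ℝ)) =
      -∫ θ in (-π)..π, Real.sin θ • g (Real.cos θ : ℝ) := by
    rw [← intervalIntegral.integral_neg]; simp
  rw [h3] at hneg ⊢
  refine neg_eq_zero.2 ((smul_eq_zero_iff_right (two_ne_zero (α := ℝ))).1 ?_)
  rw [two_smul]
  nth_rw 1 [hneg]
  exact neg_add_cancel _


theorem joukowski_sub {u z : ℂ} (hu : u ≠ 0) (hz : z ≠ 0) :
    joukowski u - joukowski z = (u - z) * (u - z⁻¹) / (2 * u) := by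
  unfold joukowski; field_simp; ring

theorem sub_ne_zero_of_mem_circle {ρ : ℝ} {u w : ℂ} (hw : ‖w‖ < ρ)
    (hu : u ∈ Metric.sphere (0 : ℂ) ρ) : u - w ≠ 0 := fun h => by
  rw [mem_sphere_zero_iff_norm, sub_eq_zero.1 h] at hu
  linarith

theorem ne_zero_of_mem_circle {ρ : ℝ} {u : ℂ} (hρ : 1 < ρ)
    (hu : u ∈ Metric.sphere (0 : ℂ) ρ) : u ≠ 0 :=
  norm_pos_iff.1 (by rw [mem_sphere_zero_iff_norm] at hu; linarith)

theorem norm_inv_lt_of_one_le {ρ : ℝ} {z : ℂ} (hρ : 1 < ρ) (h1 : 1 ≤ ‖z‖) : ‖z⁻¹‖ < ρ := by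
  rw [norm_inv]; exact (inv_le_one_of_one_le₀ h1).trans_lt hρ

theorem continuousOn_joukowski_kernel {ρ : ℝ} {z : ℂ} (hρ : 1 < ρ) (h1 : 1 ≤ ‖z‖) (h2 : ‖z‖ < ρ) :
    ContinuousOn (fun u : ℂ => (u - z)⁻¹ + (u - z⁻¹)⁻¹ - u⁻¹) (Metric.sphere 0 ρ) := fun _ hu =>
  ((((continuousAt_id.sub continuousAt_const).inv₀ (sub_ne_zero_of_mem_circle h2 hu)).add
    ((continuousAt_id.sub continuousAt_const).inv₀
      (sub_ne_zero_of_mem_circle (norm_inv_lt_of_one_le hρ h1) hu))).sub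
    (continuousAt_inv₀ (ne_zero_of_mem_circle hρ hu))).continuousWithinAt

theorem continuousOn_comp_joukowski {E : Type*} [NormedAddCommGroup E] {ρ : ℝ} (hρ : 1 < ρ) {f : ℂ → E}
    (hf : ContinuousOn f (closure (bernsteinEllipse ρ))) :
    ContinuousOn (fun u => f (joukowski u)) (Metric.sphere 0 ρ) := by
  refine hf.comp (fun u hu => ?_) (fun u hu => ?_)
  · exact (continuousAt_joukowski (ne_zero_of_mem_circle hρ hu)).continuousWithinAt
  · rw [mem_sphere_zero_iff_norm] at hu
    exact joukowski_mem_closure hρ (by linarith) hu.le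

/-- **Cauchy's integral formula** on the Bernstein ellipse, pulled back to the circle of radius `ρ`:
the kernel is `joukowski' u / (joukowski u - joukowski z)` in partial fractions. -/
theorem circleIntegral_kernel_smul {E : Type*} [NormedAddCommGroup E] [NormedSpace ℂ E]
    [CompleteSpace E] {ρ : ℝ} (hρ : 1 < ρ) {f : ℂ → E}
    (hf : DiffContOnCl ℂ f (bernsteinEllipse ρ)) {z : ℂ} (h1 : 1 ≤ ‖z‖) (h2 : ‖z‖ < ρ) :
    (∮ u in C(0, ρ), ((u - z)⁻¹ + (u - z⁻¹)⁻¹ - u⁻¹) • f (joukowski u)) =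
      (2 * Real.pi * Complex.I : ℂ) • f (joukowski z) := by
  have hz : z ≠ 0 := norm_pos_iff.1 (by linarith)
  have hzi := norm_inv_lt_of_one_le hρ h1
  have hρ0 : 0 < ρ := by linarith
  set x := joukowski z with hx
  have hxE : x ∈ bernsteinEllipse ρ := joukowski_mem_bernsteinEllipse hρ h1 h2
  have hEo := isOpen_bernsteinEllipse ρ
  have hdd : DifferentiableOn ℂ (dslope f x) (bernsteinEllipse ρ) :=
    (Complex.differentiableOn_dslope (hEo.mem_nhds hxE)).2 hf.differentiableOn
  have hdc : ContinuousOn (dslope f x) (closure (bernsteinEllipse ρ)) :=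
    (continuousOn_dslope (Filter.mem_of_superset (hEo.mem_nhds hxE) subset_closure)).2
      ⟨hf.continuousOn, hf.differentiableAt hEo hxE⟩
  have hne : ∀ u ∈ Metric.sphere (0 : ℂ) ρ, u ≠ 0 ∧ u - z ≠ 0 ∧ u - z⁻¹ ≠ 0 := fun u hu =>
    ⟨ne_zero_of_mem_circle hρ hu, sub_ne_zero_of_mem_circle h2 hu,
      sub_ne_zero_of_mem_circle hzi hu⟩
  -- The contour integral of the difference quotient moves to the unit circle and vanishes there.
  have hzero : (∮ u in C(0, ρ), ((1 - (u⁻¹) ^ 2) / 2) • dslope f x (joukowski u)) = 0 := by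
    rw [Complex.circleIntegral_eq_of_differentiable_on_annulus_off_countable one_pos hρ.le
      Set.countable_empty]
    · exact circleIntegral_joukowski_eq_zero _
    · intro u hu
      have hu1 : 1 ≤ ‖u‖ := by simpa using hu.2
      have hu2 : ‖u‖ ≤ ρ := by simpa using hu.1
      have hu0 : u ≠ 0 := norm_pos_iff.1 (by linarith)
      refine ContinuousWithinAt.smul ?_ ?_
      · exact ((continuousAt_const.sub ((continuousAt_inv₀ hu0).pow 2)).div_const
          2).continuousWithinAt
      · refine ContinuousWithinAt.comp (g := dslope f x) (t := closure (bernsteinEllipse ρ))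
          (hdc _ (joukowski_mem_closure hρ hu1 hu2))
          (continuousAt_joukowski hu0).continuousWithinAt ?_
        intro v hv
        exact joukowski_mem_closure hρ (by simpa using hv.2) (by simpa using hv.1)
    · intro u hu
      have hu1 : 1 < ‖u‖ := by simpa using hu.1.2
      have hu2 : ‖u‖ < ρ := by simpa using hu.1.1
      have hu0 : u ≠ 0 := norm_pos_iff.1 (by linarith)
      refine DifferentiableAt.smul ?_ ?_
      · exact ((differentiableAt_const _).sub ((differentiableAt_inv hu0).pow 2)).div_const 2
      · exact DifferentiableAt.comp (g := dslope f x) u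
          (hdd.differentiableAt (hEo.mem_nhds (joukowski_mem_bernsteinEllipse hρ hu1.le hu2)))
          (differentiableAt_joukowski hu0)
  have hker : Set.EqOn (fun u : ℂ => ((1 - (u⁻¹) ^ 2) / 2) • dslope f x (joukowski u))
      (fun u => ((u - z)⁻¹ + (u - z⁻¹)⁻¹ - u⁻¹) • f (joukowski u) -
        ((u - z)⁻¹ + (u - z⁻¹)⁻¹ - u⁻¹) • f x) (Metric.sphere 0 ρ) := by
    intro u hu
    obtain ⟨hu0, huz, huzi⟩ := hne u hu
    have hJ := joukowski_sub hu0 hz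
    have hJne : joukowski u ≠ x := by
      rw [← sub_ne_zero, hJ]
      exact div_ne_zero (mul_ne_zero huz huzi) (mul_ne_zero two_ne_zero hu0)
    simp only
    rw [← smul_sub, dslope_of_ne _ hJne, slope_def_module, smul_smul]
    congr 1
    rw [hJ]
    have huz' : u * z - 1 ≠ 0 := by
      intro h
      apply huzi
      field_simp
      linear_combination h
    field_simp
    ring
  have hcK := continuousOn_joukowski_kernel hρ h1 h2
  have hcf := continuousOn_comp_joukowski hρ hf.continuousOn
  have hi1 : CircleIntegrable (fun u => ((u - z)⁻¹ + (u - z⁻¹)⁻¹ - u⁻¹) • f (joukowski u)) 0 ρ :=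
    (hcK.smul hcf).circleIntegrable hρ0.le
  have hi2 : CircleIntegrable (fun u => ((u - z)⁻¹ + (u - z⁻¹)⁻¹ - u⁻¹) • f x) 0 ρ :=
    (hcK.smul continuousOn_const).circleIntegrable hρ0.le
  rw [circleIntegral.integral_congr hρ0.le hker, circleIntegral.integral_sub hi1 hi2,
    sub_eq_zero] at hzero
  rw [hzero, circleIntegral.integral_smul_const]
  congr 1
  have hi : ∀ w : ℂ, ‖w‖ < ρ → CircleIntegrable (fun u : ℂ => (u - w)⁻¹) 0 ρ := fun w hw =>
    ContinuousOn.circleIntegrable hρ0.le fun u hu =>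
      ((continuousAt_id.sub continuousAt_const).inv₀
        (sub_ne_zero_of_mem_circle hw hu)).continuousWithinAt
  have hi0 : CircleIntegrable (fun u : ℂ => u⁻¹) 0 ρ := by simpa using hi 0 (by simpa using hρ0)
  have hv : ∀ w : ℂ, ‖w‖ < ρ → (∮ u in C(0, ρ), (u - w)⁻¹) = 2 * Real.pi * Complex.I :=
    fun w hw => circleIntegral.integral_sub_inv_of_mem_ball (by simpa using hw)
  have hv0 : (∮ u in C(0, ρ), u⁻¹) = 2 * Real.pi * Complex.I := by
    simpa using hv 0 (by simpa using hρ0)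
  have hi12 : CircleIntegrable (fun u : ℂ => (u - z)⁻¹ + (u - z⁻¹)⁻¹) 0 ρ :=
    (hi z h2).add (hi z⁻¹ hzi)
  rw [circleIntegral.integral_sub hi12 hi0,
    circleIntegral.integral_add (hi z h2) (hi z⁻¹ hzi), hv z h2, hv z⁻¹ hzi, hv0]
  ring

/-- Truncated geometric expansion of the Cauchy kernel at infinity. -/
theorem inv_sub_eq_geom {u z : ℂ} (hu : u ≠ 0) (huz : u - z ≠ 0) (R : ℕ) :
    (u - z)⁻¹ = (∑ k ∈ Finset.range (R + 1), z ^ k * (u⁻¹) ^ (k + 1)) +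
      (z / u) ^ (R + 1) * (u - z)⁻¹ := by
  have hbase : (u - z)⁻¹ = u⁻¹ + z * u⁻¹ * (u - z)⁻¹ := by field_simp; ring
  rw [div_eq_mul_inv]
  induction R with
  | zero => simpa using hbase
  | succ R ih =>
    rw [Finset.sum_range_succ]
    linear_combination ih + (z * u⁻¹) ^ (R + 1) * hbase

/-- The truncated Chebyshev series of degree `R` of a function on the Bernstein ellipse, with its
truncation error at `joukowski z`. Expanding the two geometric series of the Cauchy kernel gives
the Chebyshev coefficients, and their tails give the error. -/
theorem exists_chebyshev_projection {E : Type*} [NormedAddCommGroup E] [NormedSpace ℂ E]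
    [CompleteSpace E] {ρ : ℝ} (hρ : 1 < ρ) {f : ℂ → E}
    (hf : DiffContOnCl ℂ f (bernsteinEllipse ρ)) {κ : ℝ}
    (hκ : ∀ z ∈ frontier (bernsteinEllipse ρ), ‖f z‖ ≤ κ) (R : ℕ) :
    ∃ a : ℕ → E, ∀ z : ℂ, 1 ≤ ‖z‖ → ‖z‖ < ρ →
      ‖f (joukowski z) - ∑ k ∈ Finset.range (R + 1),
        (Polynomial.Chebyshev.T ℂ k).eval (joukowski z) • a k‖ ≤
      2 * κ * ((‖z‖ / ρ) ^ (R + 1) / (1 - ‖z‖ / ρ)) := by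
  have hρ0 : 0 < ρ := by linarith
  have hcf := continuousOn_comp_joukowski hρ hf.continuousOn
  have hcinv : ∀ k : ℕ, ContinuousOn (fun u : ℂ => (u⁻¹) ^ k) (Metric.sphere 0 ρ) := fun k u hu => by
    rw [mem_sphere_zero_iff_norm] at hu
    exact ((continuousAt_inv₀ (norm_pos_iff.1 (by linarith))).pow k).continuousWithinAt
  -- Since `z ^ k + z⁻¹ ^ k = 2 T_k`, every term is doubled, but for `k = 0` the kernel takes `u⁻¹` off.
  let e : ℕ → ℂ := fun k => if k = 0 then 1 else 2
  let S : ℂ → ℂ → ℂ := fun z u => ∑ k ∈ Finset.range (R + 1),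
        (Polynomial.Chebyshev.T ℂ k).eval (joukowski z) * (e k * (u⁻¹) ^ (k + 1))
  refine ⟨fun k => (2 * Real.pi * Complex.I : ℂ)⁻¹ •
    ∮ u in C(0, ρ), (e k * (u⁻¹) ^ (k + 1)) • f (joukowski u), fun z h1 h2 => ?_⟩
  have hz : z ≠ 0 := norm_pos_iff.1 (by linarith)
  have hzi1 : ‖z⁻¹‖ ≤ 1 := by
    rw [norm_inv]; exact inv_le_one_of_one_le₀ h1
  have hzi : ‖z⁻¹‖ < ρ := hzi1.trans_lt hρ
  have hpi : (2 * Real.pi * Complex.I : ℂ) ≠ 0 := Complex.two_pi_I_ne_zero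
  have hne : ∀ u ∈ Metric.sphere (0 : ℂ) ρ, u ≠ 0 ∧ u - z ≠ 0 ∧ u - z⁻¹ ≠ 0 := fun u hu =>
    ⟨ne_zero_of_mem_circle hρ hu, sub_ne_zero_of_mem_circle h2 hu,
      sub_ne_zero_of_mem_circle hzi hu⟩
  have hcS : ContinuousOn (S z) (Metric.sphere 0 ρ) :=
    continuousOn_finsetSum _ fun k _ => continuousOn_const.mul
      (continuousOn_const.mul (hcinv (k + 1)))
  have hcK := continuousOn_joukowski_kernel hρ h1 h2
  have hi1 : CircleIntegrable (fun u => ((u - z)⁻¹ + (u - z⁻¹)⁻¹ - u⁻¹) • f (joukowski u)) 0 ρ :=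
    (hcK.smul hcf).circleIntegrable hρ0.le
  have hi2 : CircleIntegrable (fun u => S z u • f (joukowski u)) 0 ρ :=
    (hcS.smul hcf).circleIntegrable hρ0.le
  have hsum : (∮ u in C(0, ρ), S z u • f (joukowski u)) = ∑ k ∈ Finset.range (R + 1),
      (Polynomial.Chebyshev.T ℂ k).eval (joukowski z) •
        ∮ u in C(0, ρ), (e k * (u⁻¹) ^ (k + 1)) • f (joukowski u) := by
    simp only [S, Finset.sum_smul, mul_smul]
    rw [circleIntegral.integral_fun_sum]
    · simp only [circleIntegral.integral_smul]
    · intro k _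
      exact ContinuousOn.circleIntegrable hρ0.le (continuousOn_const.smul
        (continuousOn_const.smul ((hcinv (k + 1)).smul hcf)))
  have hkey : f (joukowski z) - ∑ k ∈ Finset.range (R + 1),
      (Polynomial.Chebyshev.T ℂ k).eval (joukowski z) • (2 * Real.pi * Complex.I : ℂ)⁻¹ •
        (∮ u in C(0, ρ), (e k * (u⁻¹) ^ (k + 1)) • f (joukowski u)) =
      (2 * Real.pi * Complex.I : ℂ)⁻¹ • ∮ u in C(0, ρ),
        ((z / u) ^ (R + 1) * (u - z)⁻¹ + (z⁻¹ / u) ^ (R + 1) * (u - z⁻¹)⁻¹) •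
          f (joukowski u) := by
    have hint : (∮ u in C(0, ρ),
        ((z / u) ^ (R + 1) * (u - z)⁻¹ + (z⁻¹ / u) ^ (R + 1) * (u - z⁻¹)⁻¹) •
          f (joukowski u)) = ∮ u in C(0, ρ),
        (((u - z)⁻¹ + (u - z⁻¹)⁻¹ - u⁻¹) • f (joukowski u) - S z u • f (joukowski u)) := by
      refine circleIntegral.integral_congr hρ0.le fun u hu => ?_
      obtain ⟨hu0, huz, huzi⟩ := hne u hu
      rw [← sub_smul]
      congr 1
      have hS : S z u = (∑ k ∈ Finset.range (R + 1), z ^ k * (u⁻¹) ^ (k + 1)) +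
          (∑ k ∈ Finset.range (R + 1), z⁻¹ ^ k * (u⁻¹) ^ (k + 1)) - u⁻¹ := by
        simp only [S, joukowski, eval_T_joukowski hz]
        rw [Finset.sum_range_succ', Finset.sum_range_succ' (fun k => z ^ k * (u⁻¹) ^ (k + 1)),
          Finset.sum_range_succ' (fun k => z⁻¹ ^ k * (u⁻¹) ^ (k + 1))]
        have : ∀ k : ℕ, (z ^ (k + 1) + z⁻¹ ^ (k + 1)) / 2 * (e (k + 1) * u⁻¹ ^ (k + 1 + 1)) =
            z ^ (k + 1) * u⁻¹ ^ (k + 1 + 1) + z⁻¹ ^ (k + 1) * u⁻¹ ^ (k + 1 + 1) := by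
          intro k; simp only [e, Nat.add_eq_zero_iff, one_ne_zero, and_false, if_false]; ring
        simp only [this, Finset.sum_add_distrib]
        simp [e]
        ring
      have g1 := inv_sub_eq_geom hu0 huz R
      have g2 := inv_sub_eq_geom hu0 huzi R
      rw [hS]
      linear_combination -g1 - g2
    rw [hint, circleIntegral.integral_sub hi1 hi2, circleIntegral_kernel_smul hρ hf h1 h2, hsum,
      smul_sub, inv_smul_smul₀ hpi, Finset.smul_sum]
    simp only [smul_comm (2 * Real.pi * Complex.I : ℂ)⁻¹]
  rw [hkey]
  refine (circleIntegral.norm_two_pi_i_inv_smul_integral_le_of_norm_le_const hρ0.le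
    (C := 2 * κ * ((‖z‖ / ρ) ^ (R + 1) / (ρ - ‖z‖))) fun u hu => ?_).trans (le_of_eq ?_)
  · have hfu : ‖f (joukowski u)‖ ≤ κ :=
      hκ _ (joukowski_mem_frontier hρ (mem_sphere_zero_iff_norm.1 hu))
    have hu' := mem_sphere_zero_iff_norm.1 hu
    have hd : 0 < ρ - ‖z‖ := by linarith
    have b : ∀ w : ℂ, ‖w‖ ≤ ‖z‖ → ‖(w / u) ^ (R + 1) * (u - w)⁻¹‖ ≤
        (‖z‖ / ρ) ^ (R + 1) / (ρ - ‖z‖) := by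
      intro w hw
      rw [norm_mul, norm_pow, norm_div, norm_inv, hu', div_eq_mul_inv _ (ρ - ‖z‖)]
      have := norm_sub_norm_le u w
      gcongr
      linarith
    have b1 := b z le_rfl
    have b2 := b z⁻¹ (hzi1.trans h1)
    rw [norm_smul]
    have hn := (norm_add_le ((z / u) ^ (R + 1) * (u - z)⁻¹)
      ((z⁻¹ / u) ^ (R + 1) * (u - z⁻¹)⁻¹)).trans (add_le_add b1 b2)
    calc _ ≤ ((‖z‖ / ρ) ^ (R + 1) / (ρ - ‖z‖) + (‖z‖ / ρ) ^ (R + 1) / (ρ - ‖z‖)) * κ := by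
          gcongr
      _ = _ := by ring
  · have hd : ρ - ‖z‖ ≠ 0 := by linarith
    field_simp

/-! ### The parametrized linear system -/

theorem DiffContOnCl.matrix_det {n : ℕ} {s : Set ℂ} {B : ℂ → Matrix (Fin n) (Fin n) ℂ}
    (hB : ∀ i j, DiffContOnCl ℂ (fun z => B z i j) s) : DiffContOnCl ℂ (fun z => (B z).det) s := by
  constructor
  · simp only [Matrix.det_apply]
    refine DifferentiableOn.fun_sum fun σ _ => DifferentiableOn.const_smul ?_ _
    exact DifferentiableOn.fun_finsetProd fun i _ => (hB _ _).differentiableOn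
  · refine (Continuous.matrix_det continuous_id).comp_continuousOn (f := B) ?_
    exact continuousOn_pi.2 fun i => continuousOn_pi.2 fun j => (hB i j).continuousOn

/-- Cramer's rule. For a singular `A z` both sides are zero by convention. -/
theorem solution_apply {n : ℕ} {A : ℂ → Matrix (Fin n) (Fin n) ℂ} (b : ℂ → Vec n) (z : ℂ)
    (i : Fin n) :
    solution A b z i = ((A z).det)⁻¹ * ((A z).updateCol i (b z)).det := by
  rw [← Matrix.cramer_apply, Matrix.cramer_eq_adjugate_mulVec, solution, op, Matrix.inv_def,
    Ring.inverse_eq_inv']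
  simp [Matrix.ofLp_toEuclideanCLM]

theorem op_solution {n : ℕ} {A : ℂ → Matrix (Fin n) (Fin n) ℂ} (b : ℂ → Vec n) {z : ℂ}
    (hz : IsUnit (A z)) : op (A z) (solution A b z) = b z := by
  rw [solution, ← mul_apply_eq_comp, op, op, ← map_mul,
    Matrix.mul_nonsing_inv _ ((Matrix.isUnit_iff_isUnit_det _).1 hz), map_one]
  rfl

theorem AnalyticOnEllipse.diffContOnCl_solution {n : ℕ} {ρ : ℝ}
    {A : ℂ → Matrix (Fin n) (Fin n) ℂ} {b : ℂ → Vec n} (h : AnalyticOnEllipse ρ A b) :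
    DiffContOnCl ℂ (solution A b) (bernsteinEllipse ρ) := by
  have hdet : ∀ i, DiffContOnCl ℂ
      (fun z => ((A z).det)⁻¹ * ((A z).updateCol i (b z)).det) (bernsteinEllipse ρ) := by
    intro i
    have h1 := DiffContOnCl.matrix_det h.matrix
    have h2 : DiffContOnCl ℂ (fun z => ((A z).updateCol i (b z)).det) (bernsteinEllipse ρ) := by
      refine DiffContOnCl.matrix_det fun k l => ?_
      by_cases hl : l = i
      · simpa [Matrix.updateCol_apply, hl] using h.vector k
      · simpa [Matrix.updateCol_apply, hl] using h.matrix k l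
    exact (h1.inv fun z hz =>
      ((Matrix.isUnit_iff_isUnit_det _).1 (h.invertible z hz)).ne_zero).smul h2
  constructor
  · rw [differentiableOn_euclidean]
    exact fun i => (hdet i).differentiableOn.congr fun z hz =>
      solution_apply b z i
  · have : ContinuousOn (fun z => WithLp.ofLp (solution A b z)) (closure (bernsteinEllipse ρ)) :=
      continuousOn_pi.2 fun i => (hdet i).continuousOn.congr fun z hz =>
        solution_apply b z i
    exact (PiLp.continuous_toLp 2 _).comp_continuousOn this

/-- The supremum defining `kappa` is taken over a bounded set, since the boundary is compact. -/
theorem AnalyticOnEllipse.norm_solution_le_kappa {n : ℕ} {ρ : ℝ}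
    {A : ℂ → Matrix (Fin n) (Fin n) ℂ} {b : ℂ → Vec n} (h : AnalyticOnEllipse ρ A b) {z : ℂ}
    (hz : z ∈ frontier (bernsteinEllipse ρ)) : ‖solution A b z‖ ≤ kappa ρ A b := by
  refine le_csSup ?_ (Set.mem_image_of_mem _ hz)
  refine ((isCompact_closure_bernsteinEllipse ρ).bddAbove_image
    h.diffContOnCl_solution.continuousOn.norm).mono (Set.image_mono frontier_subset_closure)

theorem kappa_nonneg {n : ℕ} (ρ : ℝ) (A : ℂ → Matrix (Fin n) (Fin n) ℂ) (b : ℂ → Vec n) :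
    0 ≤ kappa ρ A b :=
  Real.sSup_nonneg (by rintro _ ⟨z, _, rfl⟩; exact norm_nonneg _)

theorem historySpan_real_subset {n : ℕ} (A : ℂ → Matrix (Fin n) (Fin n) ℂ) (b : ℂ → Vec n) (M : ℕ)
    {s : Vec n} (hs : s ∈ historySpan ℝ A b M) : s ∈ historySpan ℂ A b M :=
  Submodule.span_le_restrictScalars ℝ ℂ _ hs

/-- The residual has a minimizer on the span: the image of the span under the matrix is a closed
subspace, so it contains a point nearest to the right-hand side. -/
theorem exists_isInitialGuess {𝕜 : Type} [RCLike 𝕜] {n : ℕ} [NormedSpace 𝕜 (Vec n)]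
    [FiniteDimensional 𝕜 (Vec n)]
    (A : ℂ → Matrix (Fin n) (Fin n) ℂ) (b : ℂ → Vec n) (M : ℕ)
    (hop : ∀ (c : 𝕜) (v : Vec n), op (A (nextTime M : ℂ)) (c • v) = c • op (A (nextTime M : ℂ)) v) :
    ∃ s : Vec n, IsInitialGuess 𝕜 A b M s := by
  let f : Vec n →ₗ[𝕜] Vec n :=
    { toFun := op (A (nextTime M : ℂ)), map_add' := map_add _, map_smul' := hop }
  let W := (historySpan 𝕜 A b M).map f
  have hW : IsClosed (W : Set (Vec n)) := Submodule.closed_of_finiteDimensional W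
  have := FiniteDimensional.proper_rclike 𝕜 (Vec n)
  obtain ⟨w, ⟨s, hs, rfl⟩, hw⟩ := hW.exists_infDist_eq_dist ⟨0, W.zero_mem⟩ (b (nextTime M : ℂ))
  refine ⟨s, hs, fun v hv => ?_⟩
  have := Metric.infDist_le_dist_of_mem (x := b (nextTime M : ℂ))
    (show f v ∈ (W : Set (Vec n)) from ⟨v, hv, rfl⟩)
  rw [hw, dist_comm, dist_comm (b _), dist_eq_norm, dist_eq_norm] at this
  exact this

/-! ### The error of the extrapolated initial guess -/

/-- The weighted sum of past solutions extrapolates the truncated Chebyshev series exactly; the error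
is the truncation error at `t` plus the amplified truncation error on `[-1, 1]`. -/
theorem exists_mem_historySpan_norm_sub_le {n : ℕ} {ρ : ℝ} (hρ : 1 < ρ)
    {A : ℂ → Matrix (Fin n) (Fin n) ℂ} {b : ℂ → Vec n} (hAb : AnalyticOnEllipse ρ A b)
    {M R : ℕ} (hM : 2 ≤ M) (hR : 4 * (R : ℝ) ^ 2 ≤ M - 1) {t : ℝ} (ht : 1 ≤ t)
    (htρ : t + √(t ^ 2 - 1) < ρ) :
    ∃ s ∈ historySpan ℝ A b M, ‖s - solution A b t‖ ≤
      2 * kappa ρ A b * (((t + √(t ^ 2 - 1)) / ρ) ^ (R + 1) / (1 - (t + √(t ^ 2 - 1)) / ρ) +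
        2 * (t + √(t ^ 2 - 1)) ^ R * ((1 / ρ) ^ (R + 1) / (1 - 1 / ρ))) := by
  set w := t + √(t ^ 2 - 1) with hw
  have hw1 : 1 ≤ w := by have := Real.sqrt_nonneg (t ^ 2 - 1); linarith
  have hρ0 : 0 < ρ := by linarith
  have hκ := kappa_nonneg ρ A b
  obtain ⟨c, hc, hcP⟩ := exists_extrapolation_weights hM hR ht
  obtain ⟨a, ha⟩ := exists_chebyshev_projection hρ hAb.diffContOnCl_solution
    (fun z hz => hAb.norm_solution_le_kappa hz) R
  let p : ℂ → Vec n := fun x => ∑ k ∈ Finset.range (R + 1),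
    (Polynomial.Chebyshev.T ℂ k).eval x • a k
  have hp : ∑ k, c k • p (pastTime M k) = p t := by
    simp only [p, Finset.smul_sum]
    rw [Finset.sum_comm]
    refine Finset.sum_congr rfl fun j hj => ?_
    have h1 := hcP (Polynomial.Chebyshev.T ℝ j) (by
      rw [Polynomial.Chebyshev.natDegree_T]
      have := Finset.mem_range.1 hj
      simp; omega)
    have h2 := congrArg (fun r : ℝ => (r : ℂ)) h1
    simp only [Complex.ofReal_sum, Complex.ofReal_mul,
      Polynomial.Chebyshev.complex_ofReal_eval_T] at h2
    rw [← h2, Finset.sum_smul]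
    refine Finset.sum_congr rfl fun k _ => ?_
    rw [mul_smul, Complex.coe_smul]
  have e1 : ∀ k, ‖solution A b (pastTime M k) - p (pastTime M k)‖ ≤
      2 * kappa ρ A b * ((1 / ρ) ^ (R + 1) / (1 - 1 / ρ)) := by
    intro k
    obtain ⟨u, hu, hux⟩ := exists_joukowski_eq_of_mem_Icc (pastTime_mem_Icc hM k)
    have := ha u hu.ge (hu.trans_lt hρ)
    rwa [hux, hu] at this
  have e2 : ‖solution A b t - p t‖ ≤ 2 * kappa ρ A b * ((w / ρ) ^ (R + 1) / (1 - w / ρ)) := by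
    have hn : ‖((w : ℝ) : ℂ)‖ = w := by
      rw [Complex.norm_real, Real.norm_of_nonneg (by linarith)]
    have := ha ((w : ℝ) : ℂ) (by rw [hn]; exact hw1) (by rw [hn]; exact htρ)
    rwa [hn, joukowski_add_sqrt ht] at this
  refine ⟨∑ k, c k • solution A b (pastTime M k), Submodule.sum_mem _ fun k _ =>
    Submodule.smul_mem _ _ (Submodule.subset_span ⟨k, rfl⟩), ?_⟩
  have hsplit : ∑ k, c k • solution A b (pastTime M k) - solution A b t =
      ∑ k, c k • (solution A b (pastTime M k) - p (pastTime M k)) - (solution A b t - p t) := by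
    simp only [smul_sub, Finset.sum_sub_distrib, hp]
    abel
  have e3 : ‖∑ k, c k • (solution A b (pastTime M k) - p (pastTime M k))‖ ≤
      2 * w ^ R * (2 * kappa ρ A b * ((1 / ρ) ^ (R + 1) / (1 - 1 / ρ))) := by
    have h0 : 0 ≤ 1 - 1 / ρ := by
      rw [sub_nonneg, div_le_one hρ0]; exact hρ.le
    calc _ ≤ ∑ k, |c k| * (2 * kappa ρ A b * ((1 / ρ) ^ (R + 1) / (1 - 1 / ρ))) :=
          norm_sum_le_of_le _ fun k _ => by
            rw [norm_smul, Real.norm_eq_abs]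
            exact mul_le_mul_of_nonneg_left (e1 k) (abs_nonneg _)
      _ ≤ _ := by
          rw [← Finset.sum_mul]
          exact mul_le_mul_of_nonneg_right hc (by positivity)
  rw [hsplit]
  refine (norm_sub_le _ _).trans ((add_le_add e3 e2).trans (le_of_eq ?_))
  ring

theorem nextTime_gt_one {M : ℕ} (hM : 2 ≤ M) : 1 < nextTime M := by
  have hM' : (2 : ℝ) ≤ M := by exact_mod_cast hM
  have : 0 < stepSize M := div_pos two_pos (by linarith)
  unfold nextTime; linarith

theorem two_le_constC {M : ℕ} (hM : 2 ≤ M) (R : ℕ) : 2 ≤ constC M R := by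
  have hM' : (2 : ℝ) ≤ M := by exact_mod_cast hM
  have h5 : 2 ≤ √(5 : ℝ) := Real.le_sqrt_of_sq_le (by norm_num)
  have h1 : 1 ≤ √(2 * (R : ℝ) + 1) := Real.one_le_sqrt.2 (by linarith [Nat.cast_nonneg (α := ℝ) R])
  have h2 : √(2 * ((M : ℝ) - 1)) ≤ 2 * √M := by
    rw [show (2 : ℝ) * √M = √(2 ^ 2 * M) by rw [Real.sqrt_mul (by norm_num)]; simp]
    exact Real.sqrt_le_sqrt (by linarith)
  have h3 : 0 < √(2 * ((M : ℝ) - 1)) := Real.sqrt_pos.2 (by linarith)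
  rw [constC, le_div_iff₀ h3]
  calc 2 * √(2 * ((M : ℝ) - 1)) ≤ 2 * (2 * √M) := by gcongr
    _ ≤ 5 * 2 * 1 * √M := by have := Real.sqrt_nonneg (M : ℝ); linarith
    _ ≤ _ := by gcongr

/-- The extrapolated guess satisfies the error bound. For the second term in the bracket the crude
estimates `2 ≤ constC M R` and `√(w² - 1) ≤ w`, with `w = ρ * rate ρ M`, are enough. -/
theorem residualNorm_le_errorBound {n : ℕ} {ρ : ℝ} (hρ : 1 < ρ)
    {A : ℂ → Matrix (Fin n) (Fin n) ℂ} {b : ℂ → Vec n} (hAb : AnalyticOnEllipse ρ A b)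
    {M R : ℕ} (hM : 2 ≤ M) (hr : rate ρ M < 1) (hR : (R : ℝ) ≤ 1 / 2 * √((M : ℝ) - 1)) :
    ∃ s ∈ historySpan ℝ A b M, residualNorm A b M s ≤ errorBound ρ A b M R := by
  have hρ0 : 0 < ρ := by linarith
  have hM' : (2 : ℝ) ≤ M := by exact_mod_cast hM
  have ht := nextTime_gt_one hM
  have hR' : 4 * (R : ℝ) ^ 2 ≤ M - 1 := by
    have h1 := Real.sq_sqrt (show (0 : ℝ) ≤ M - 1 by linarith)
    have h2 := Nat.cast_nonneg (α := ℝ) R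
    nlinarith
  set w := nextTime M + √(nextTime M ^ 2 - 1) with hw
  have hrw : rate ρ M = w / ρ := rfl
  have hw1 : 1 < w := by have := Real.sqrt_nonneg (nextTime M ^ 2 - 1); linarith
  have hwρ : w < ρ := by rwa [hrw, div_lt_one hρ0] at hr
  obtain ⟨s, hs, hsb⟩ := exists_mem_historySpan_norm_sub_le hρ hAb hM hR' ht.le hwρ
  rw [← hw] at hsb
  refine ⟨s, hs, ?_⟩
  have htE : (nextTime M : ℂ) ∈ closure (bernsteinEllipse ρ) := by
    rw [← joukowski_add_sqrt ht.le]
    have hn : ‖((w : ℝ) : ℂ)‖ = w := by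
      rw [Complex.norm_real, Real.norm_of_nonneg (by linarith)]
    exact joukowski_mem_closure hρ (by rw [hn]; exact hw1.le) (by rw [hn]; exact hwρ.le)
  have hres : residualNorm A b M s ≤
      ‖op (A (nextTime M : ℂ))‖ * ‖s - solution A b (nextTime M)‖ := by
    rw [residualNorm]
    nth_rw 1 [← op_solution b (hAb.invertible _ htE)]
    rw [← map_sub]
    exact ContinuousLinearMap.le_opNorm _ _
  refine hres.trans ((mul_le_mul_of_nonneg_left hsb (norm_nonneg _)).trans ?_)
  have hκ := kappa_nonneg ρ A b
  rw [errorBound, hrw]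
  have hsq : 0 < √(w ^ 2 - 1) := Real.sqrt_pos.2 (by nlinarith)
  have hsq' : √(w ^ 2 - 1) ≤ w := by
    rw [Real.sqrt_le_left (by linarith)]; linarith
  have hC := two_le_constC hM R
  have hρw : ρ ^ 2 * (w / ρ) ^ 2 - 1 = w ^ 2 - 1 := by field_simp
  rw [hρw]
  have hρ1 : 0 < ρ - 1 := by linarith
  have key : 2 * w ^ R * ((1 / ρ) ^ (R + 1) / (1 - 1 / ρ)) ≤
      constC M R * ρ / ((ρ - 1) * √(w ^ 2 - 1)) * (w / ρ) ^ (R + 1) := by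
    have l : 2 * w ^ R * ((1 / ρ) ^ (R + 1) / (1 - 1 / ρ)) =
        2 * (ρ / (ρ - 1) * (w ^ R / ρ ^ (R + 1))) := by
      rw [one_div, inv_pow]; field_simp
    have r : constC M R * ρ / ((ρ - 1) * √(w ^ 2 - 1)) * (w / ρ) ^ (R + 1) =
        (constC M R * (w / √(w ^ 2 - 1))) * (ρ / (ρ - 1) * (w ^ R / ρ ^ (R + 1))) := by
      rw [div_pow]; field_simp; ring
    rw [l, r]
    refine mul_le_mul_of_nonneg_right ?_ (by positivity)
    have : 1 ≤ w / √(w ^ 2 - 1) := by rwa [one_le_div hsq]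
    nlinarith
  calc ‖op (A (nextTime M : ℂ))‖ * (2 * kappa ρ A b * ((w / ρ) ^ (R + 1) / (1 - w / ρ) +
        2 * w ^ R * ((1 / ρ) ^ (R + 1) / (1 - 1 / ρ))))
      ≤ ‖op (A (nextTime M : ℂ))‖ * (2 * kappa ρ A b * ((w / ρ) ^ (R + 1) / (1 - w / ρ) +
        constC M R * ρ / ((ρ - 1) * √(w ^ 2 - 1)) * (w / ρ) ^ (R + 1))) := by gcongr
    _ = _ := by ring

/-! ### Root-exponential decay of the bound -/

section Decay

open Asymptotics Filter Topology

theorem nextTime_add_sqrt {M : ℕ} (hM : 2 ≤ M) :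
    nextTime M + √(nextTime M ^ 2 - 1) = 1 + 2 / (√(M : ℝ) - 1) := by
  have hM' : (2 : ℝ) ≤ M := by exact_mod_cast hM
  have hs : 1 < √(M : ℝ) := Real.lt_sqrt_of_sq_lt (by linarith)
  have hsq := Real.sq_sqrt (show (0 : ℝ) ≤ M by linarith)
  have h1 : nextTime M ^ 2 - 1 = (stepSize M * √(M : ℝ)) ^ 2 := by
    have : (M : ℝ) - 1 ≠ 0 := by linarith
    rw [mul_pow, hsq, nextTime, stepSize]
    field_simp
    ring
  have h0 : 0 ≤ stepSize M := div_nonneg two_pos.le (by linarith)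
  rw [h1, Real.sqrt_sq (by positivity), nextTime, stepSize]
  have h2 : (M : ℝ) - 1 = (√(M : ℝ) - 1) * (√(M : ℝ) + 1) := by linarith
  have h3 : √(M : ℝ) - 1 ≠ 0 := by linarith
  have h4 : √(M : ℝ) + 1 ≠ 0 := by linarith
  rw [h2]
  field_simp
  ring

theorem tendsto_sqrt_natCast : Tendsto (fun M : ℕ => √(M : ℝ)) atTop atTop :=
  Real.tendsto_sqrt_atTop.comp tendsto_natCast_atTop_atTop

theorem tendsto_rate (ρ : ℝ) : Tendsto (rate ρ) atTop (𝓝 (1 / ρ)) := by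
  have h : Tendsto (fun M : ℕ => (1 + 2 / (√(M : ℝ) - 1)) / ρ) atTop (𝓝 ((1 + 0) / ρ)) :=
    (((tendsto_atTop_add_const_right _ (-1) tendsto_sqrt_natCast).const_div_atTop 2).const_add
      1).div_const ρ
  rw [add_zero] at h
  refine h.congr' ?_
  filter_upwards [eventually_ge_atTop 2] with M hM
  rw [rate, nextTime_add_sqrt hM]

theorem tendsto_nextTime : Tendsto nextTime atTop (𝓝 1) := by
  have h : Tendsto (fun M : ℕ => 1 + 2 / ((M : ℝ) + (-1))) atTop (𝓝 (1 + 0)) :=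
    ((tendsto_atTop_add_const_right _ (-1) tendsto_natCast_atTop_atTop).const_div_atTop 2).const_add 1
  rw [add_zero] at h
  exact h

theorem AnalyticOnEllipse.isBigO_norm_op {n : ℕ} {ρ : ℝ} (hρ : 1 < ρ)
    {A : ℂ → Matrix (Fin n) (Fin n) ℂ} {b : ℂ → Vec n} (h : AnalyticOnEllipse ρ A b) :
    (fun M : ℕ => ‖op (A (nextTime M : ℂ))‖) =O[atTop] (fun _ : ℕ => (1 : ℝ)) := by
  have h1 : (1 : ℂ) ∈ bernsteinEllipse ρ := by
    have := joukowski_mem_bernsteinEllipse hρ (u := 1) (by simp) (by simpa using hρ)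
    simpa [joukowski] using this
  have hA : ContinuousAt A 1 := continuousAt_pi.2 fun i => continuousAt_pi.2 fun j =>
    ((h.matrix i j).differentiableAt (isOpen_bernsteinEllipse ρ) h1).continuousAt
  let l : Matrix (Fin n) (Fin n) ℂ →ₗ[ℂ] (Vec n →L[ℂ] Vec n) :=
    { toFun := op
      map_add' := map_add (Matrix.toEuclideanCLM (n := Fin n) (𝕜 := ℂ))
      map_smul' := map_smul (Matrix.toEuclideanCLM (n := Fin n) (𝕜 := ℂ)) }
  have hop : Continuous (op (n := n)) := l.continuous_of_finiteDimensional
  have ht : Tendsto (fun M : ℕ => (nextTime M : ℂ)) atTop (𝓝 1) := by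
    rw [← Complex.ofReal_one]
    exact (Complex.continuous_ofReal.tendsto 1).comp tendsto_nextTime
  exact ((hop.continuousAt.tendsto.comp (hA.tendsto.comp ht)).norm).isBigO_one ℝ

theorem constC_le {M R : ℕ} (hM : 2 ≤ M) (hR : (R : ℝ) ≤ 1 / 2 * √((M : ℝ) - 1)) :
    constC M R ≤ 30 * √(M : ℝ) := by
  have hM' : (2 : ℝ) ≤ M := by exact_mod_cast hM
  have hs : 1 < √(M : ℝ) := Real.lt_sqrt_of_sq_lt (by linarith)
  have h5 : √(5 : ℝ) ≤ 3 := Real.sqrt_le_iff.2 (by norm_num)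
  have hR0 := Nat.cast_nonneg (α := ℝ) R
  have h1 : √(2 * (R : ℝ) + 1) ≤ 2 * √(M : ℝ) := by
    have : √((M : ℝ) - 1) ≤ √M := Real.sqrt_le_sqrt (by linarith)
    rw [Real.sqrt_le_left (by positivity)]
    nlinarith
  have h2 : √(M : ℝ) ≤ √(2 * ((M : ℝ) - 1)) := Real.sqrt_le_sqrt (by linarith)
  have h3 : √(M : ℝ) / √(2 * ((M : ℝ) - 1)) ≤ 1 := div_le_one_of_le₀ h2 (Real.sqrt_nonneg _)
  rw [constC, mul_div_assoc]
  calc 5 * √5 * √(2 * (R : ℝ) + 1) * (√(M : ℝ) / √(2 * ((M : ℝ) - 1)))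
      ≤ 5 * 3 * (2 * √(M : ℝ)) * 1 := by gcongr
    _ = _ := by ring

theorem floor_half_sqrt_le (M : ℕ) :
    ((⌊1 / 2 * √((M : ℝ) - 1)⌋₊ : ℕ) : ℝ) ≤ 1 / 2 * √((M : ℝ) - 1) :=
  Nat.floor_le (by positivity)

/-- The first term of the bracket is bounded, and both `constC` and `1 / √(ρ² r² - 1)` are `O(√M)`. -/
theorem isBigO_bracket {ρ : ℝ} (hρ : 1 < ρ) :
    (fun M : ℕ => 1 / (1 - rate ρ M) + constC M ⌊1 / 2 * √((M : ℝ) - 1)⌋₊ * ρ /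
      ((ρ - 1) * √(ρ ^ 2 * rate ρ M ^ 2 - 1))) =O[atTop] (fun M : ℕ => √(M : ℝ) ^ 2) := by
  have hρ0 : 0 < ρ := by linarith
  have hρ1 : 0 < ρ - 1 := by linarith
  refine IsBigO.add ?_ ?_
  · have h0 : (1 : ℝ) - 1 / ρ ≠ 0 := by
      rw [sub_ne_zero, ne_comm]; exact ((div_lt_one hρ0).2 hρ).ne
    have h1 : Tendsto (fun M : ℕ => 1 / (1 - rate ρ M)) atTop (𝓝 (1 / (1 - 1 / ρ))) :=
      tendsto_const_nhds.div ((tendsto_rate ρ).const_sub 1) h0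
    refine (h1.isBigO_one ℝ).trans (IsBigO.of_bound 1 ?_)
    filter_upwards [eventually_ge_atTop 2] with M hM
    have hM' : (2 : ℝ) ≤ M := by exact_mod_cast hM
    rw [Real.sq_sqrt (by linarith), norm_one, Real.norm_of_nonneg (by linarith)]
    linarith
  · refine IsBigO.of_bound (30 * (ρ / (ρ - 1))) ?_
    filter_upwards [eventually_ge_atTop 2] with M hM
    have hM' : (2 : ℝ) ≤ M := by exact_mod_cast hM
    have hs : 1 < √(M : ℝ) := Real.lt_sqrt_of_sq_lt (by linarith)
    have hC := constC_le hM (floor_half_sqrt_le M)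
    have hC0 := (zero_le_two (α := ℝ)).trans (two_le_constC hM ⌊1 / 2 * √((M : ℝ) - 1)⌋₊)
    have hw : ρ ^ 2 * rate ρ M ^ 2 = (1 + 2 / (√(M : ℝ) - 1)) ^ 2 := by
      rw [rate, nextTime_add_sqrt hM]; field_simp
    have hsq : 1 / √(M : ℝ) ≤ √(ρ ^ 2 * rate ρ M ^ 2 - 1) := by
      refine Real.le_sqrt_of_sq_le ?_
      rw [hw]
      have h1 : 1 / √(M : ℝ) ≤ 2 / (√(M : ℝ) - 1) := by
        rw [div_le_div_iff₀ (by linarith) (by linarith)]; linarith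
      have h2 : 0 < 1 / √(M : ℝ) := by positivity
      nlinarith
    rw [Real.norm_of_nonneg (by positivity), Real.norm_of_nonneg (by positivity)]
    calc _ ≤ 30 * √(M : ℝ) * ρ / ((ρ - 1) * (1 / √(M : ℝ))) := by gcongr
      _ = _ := by field_simp

/-- The power of `ρ * rate ρ M = 1 + O(1 / √M)` stays bounded since its exponent is `O(√M)`; the power
of `ρ⁻¹` gives the root-exponential decay. -/
theorem isBigO_rate_pow {ρ : ℝ} (hρ : 1 < ρ) :
    (fun M : ℕ => rate ρ M ^ (⌊1 / 2 * √((M : ℝ) - 1)⌋₊ + 1)) =O[atTop]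
      (fun M : ℕ => Real.exp (-(Real.log ρ / 2) * √(M : ℝ))) := by
  have hρ0 : 0 < ρ := by linarith
  have hl : 0 < Real.log ρ := Real.log_pos hρ
  refine IsBigO.of_bound (Real.exp (4 + Real.log ρ / 2)) ?_
  filter_upwards [eventually_ge_atTop 4] with M hM
  have hM' : (4 : ℝ) ≤ M := by exact_mod_cast hM
  have hs : 2 ≤ √(M : ℝ) := Real.le_sqrt_of_sq_le (by linarith)
  have hsq := Real.sq_sqrt (show (0 : ℝ) ≤ M by linarith)
  set R := ⌊1 / 2 * √((M : ℝ) - 1)⌋₊ with hR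
  have hR1 := floor_half_sqrt_le M
  have hR2 : 1 / 2 * √((M : ℝ) - 1) < R + 1 := Nat.lt_floor_add_one _
  have hs1 : √((M : ℝ) - 1) ≤ √M := Real.sqrt_le_sqrt (by linarith)
  have hs2 : √(M : ℝ) - 1 ≤ √((M : ℝ) - 1) := Real.le_sqrt_of_sq_le (by nlinarith)
  have hw0 : 0 ≤ 2 / (√(M : ℝ) - 1) := div_nonneg two_pos.le (by linarith)
  have hw : 2 / (√(M : ℝ) - 1) * (R + 1) ≤ 4 := by
    rw [div_mul_eq_mul_div, div_le_iff₀ (by linarith)]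
    linarith
  have h1 : (1 + 2 / (√(M : ℝ) - 1)) ^ (R + 1) ≤ Real.exp 4 := by
    calc (1 + 2 / (√(M : ℝ) - 1)) ^ (R + 1) ≤ Real.exp (2 / (√(M : ℝ) - 1)) ^ (R + 1) := by
          gcongr
          rw [add_comm]; exact Real.add_one_le_exp _
      _ = Real.exp (2 / (√(M : ℝ) - 1) * (R + 1)) := by
          rw [← Real.exp_nat_mul]; push_cast; ring_nf
      _ ≤ _ := Real.exp_le_exp.2 hw
  have h2 : (ρ ^ (R + 1))⁻¹ ≤ Real.exp (Real.log ρ / 2 + -(Real.log ρ / 2) * √(M : ℝ)) := by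
    have : ρ ^ (R + 1) = Real.exp (Real.log ρ * (R + 1)) := by
      rw [← Real.rpow_natCast, Real.rpow_def_of_pos hρ0]; push_cast; rfl
    rw [this, ← Real.exp_neg, Real.exp_le_exp]
    nlinarith
  rw [rate, nextTime_add_sqrt (by omega), Real.norm_of_nonneg (by positivity),
    Real.norm_of_nonneg (Real.exp_pos _).le, div_pow, div_eq_mul_inv]
  calc _ ≤ Real.exp 4 * Real.exp (Real.log ρ / 2 + -(Real.log ρ / 2) * √(M : ℝ)) := by gcongr
    _ = _ := by rw [← Real.exp_add, ← Real.exp_add, add_assoc]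

theorem isBigO_errorBound {n : ℕ} {ρ : ℝ} (hρ : 1 < ρ)
    {A : ℂ → Matrix (Fin n) (Fin n) ℂ} {b : ℂ → Vec n} (hAb : AnalyticOnEllipse ρ A b)
    {c : ℝ} (hc : c < Real.log ρ / 2) :
    (fun M : ℕ => errorBound ρ A b M ⌊1 / 2 * √((M : ℝ) - 1)⌋₊) =O[atTop]
      (fun M : ℕ => Real.exp (-c * √(M : ℝ))) := by
  have h1 := (((hAb.isBigO_norm_op hρ).const_mul_left 2).mul
    (isBigO_const_const (kappa ρ A b) (one_ne_zero (α := ℝ)) atTop)).mul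
    (isBigO_bracket hρ) |>.mul (isBigO_rate_pow hρ)
  refine h1.trans ?_
  have h2 : (fun M : ℕ => √(M : ℝ) ^ 2) =O[atTop]
      (fun M : ℕ => Real.exp ((Real.log ρ / 2 - c) * √(M : ℝ))) :=
    ((isLittleO_pow_exp_pos_mul_atTop 2 (sub_pos.2 hc)).comp_tendsto tendsto_sqrt_natCast).isBigO
  refine (h2.mul (isBigO_refl (fun M : ℕ => Real.exp (-(Real.log ρ / 2) * √(M : ℝ)))
    atTop)).congr (fun M => by ring) (fun M => ?_)
  rw [← Real.exp_add]
  ring_nf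

end Decay

/-! ### The initial guess and its error bound -/

theorem theorem2 {n : ℕ} (ρ : ℝ) (hρ : 1 < ρ)
    (A : ℂ → Matrix (Fin n) (Fin n) ℂ) (b : ℂ → Vec n) (hAb : AnalyticOnEllipse ρ A b) :
    -- the initial guess exists and satisfies the error bound, over real and complex scalars
    (∀ M : ℕ, 2 ≤ M → rate ρ M < 1 →
      (∃ s : Vec n, IsInitialGuess ℝ A b M s) ∧ (∃ s : Vec n, IsInitialGuess ℂ A b M s) ∧
      ∀ R : ℕ, (R : ℝ) ≤ 1 / 2 * √((M : ℝ) - 1) →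
        ∀ s : Vec n, IsInitialGuess ℝ A b M s ∨ IsInitialGuess ℂ A b M s →
          residualNorm A b M s ≤ errorBound ρ A b M R) ∧
    -- with the largest admissible `R`, the bound decays root-exponentially in `M`
    (∀ c : ℝ, c < Real.log ρ / 2 →
      Asymptotics.IsBigO Filter.atTop
        (fun M : ℕ => errorBound ρ A b M ⌊1 / 2 * √((M : ℝ) - 1)⌋₊)
        (fun M : ℕ => Real.exp (-c * √(M : ℝ)))) := by
  refine ⟨fun M hM hr => ⟨exists_isInitialGuess A b M fun c v => ?_,
    exists_isInitialGuess A b M fun c v => map_smul _ c v, fun R hR s hs => ?_⟩,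
    fun c hc => isBigO_errorBound hρ hAb hc⟩
  · rw [← Complex.coe_smul, map_smul, Complex.coe_smul]
  · obtain ⟨v, hv, hvb⟩ := residualNorm_le_errorBound hρ hAb hM hr hR
    rcases hs with hs | hs
    · exact (hs.2 v hv).trans hvb
    · exact (hs.2 v (historySpan_real_subset A b M hv)).trans hvb
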